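/- Consider an $s$-stage two-step Runge--Kutta (TSRK) method for $u'=F(u)$ with real coefficients, $$y_i^n = d_i u^{n-1} + (1-d_i)u^n + \Delta t\sum_{j=1}^s \hat a_{ij}F(y_j^{n-1}) + \Delta t\sum_{j=1}^s a_{ij}F(y_j^n)\quad(1\le i\le s),$$ $$u^{n+1} = \theta u^{n-1} + (1-\theta)u^n + \Delta t\sum_{j=1}^s \hat b_jF(y_j^{n-1}) + \Delta t\sum_{j=1}^s b_jF(y_j^n).$$ Assume that the method is irreducible, that is: * it is not HS-reducible: no two stages have the same $d_i$ and the same rows of $(a_{ij})$ and $(\hat a_{ij})$, and the method does not have both a stage identically equal to $u^n$ and a stage identically equal to $u^{n-1}$ (in which case $u^{n-1}$ would occur twice among the values at which $F$ is evaluated); * it is not DJ-reducible: there is no nonempty set $S$ of stages with $b_j=\hat b_j=0$ for $j\in S$ and $a_{ij}=\hat a_{ij}=0$ for $i\notin S$, $j\in S$. The SSP coefficient is the supremum of the constants $C\ge 0$ such that, for all $F:\mathbb R^N\to\mathbb R^N$, all convex functionals $\|\cdot\|$ on $\mathbb R^N$ and all $\Delta t_{FE}>0$ with $\|v+\sigma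 F(v)\|\le\|v\|$ for all $v$ and $0\le\sigma\le\Delta t_{FE}$, every step of the method with $0<\Delta t\le C\,\Delta t_{FE}$ satisfies $\|u^{n+1}\|\le\max\{\|u^n\|,\|u^{n-1}\|,\|y_1^{n-1}\|,\dots,\|y_s^{n-1}\|\}$, where the inputs $u^{n-1},u^n,y^{n-1}_j$ are arbitrary except that $y_j^{n-1}=u^{n-1}$ whenever stage $j$ is identically equal to $u^n$. The method has order $p$ if, for every $C^\infty$ system $u'=F(u)$ and every exact solution $\tilde u$ near $t_n$, the value $u^{n+1}$ computed from exact values $\tilde u(t_n-\Delta t),\tilde u(t_n)$ and from previous stages that satisfy the stage equations with exact solution values at the grid points $t_n, t_n-\Delta t,\dots,t_n-p\,\Delta t$ (all these stages, and the starting stages at $t_n-(p+1)\Delta t$, tending to $\tilde u(t_n)$ as $\Delta t\to0$) satisfies $u^{n+1}-\tilde u(t_n+\Delta t)=O(\Delta t^{p+1})$ as $\Delta t\to 0^+$. With the abscissae $c_i=\sum_j(a_{ij}+\hat a_{ij})-d_i$, the method has stage order at least $q$ if $$\tau_{k,i}=\frac{c_i^k-(-1)^kd_i}{k!}-\frac{\sum_j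 a_{ij}c_j^{k-1}+\sum_j\hat a_{ij}(c_j-1)^{k-1}}{(k-1)!}=0\quad\text{for all } 1\le k\le q,\ 1\le i\le s.$$ **Theorem.** Any irreducible TSRK method of order $p$ with positive SSP coefficient has stage order at least $\lfloor\frac{p-1}{2}\rfloor$. -/

import Mathlib

open Filter Topology Asymptotics
open scoped NNReal ENNReal

noncomputable section

/-- Coefficients of an `s`-stage two-step Runge-Kutta (TSRK) method
`y_i^n = d_i u^{n-1} + (1 - d_i) u^n + Δt ∑ â_ij F(y_j^{n-1}) + Δt ∑ a_ij F(y_j^n)`,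
`u^{n+1} = θ u^{n-1} + (1 - θ) u^n + Δt ∑ b̂_j F(y_j^{n-1}) + Δt ∑ b_j F(y_j^n)`. -/
structure TSRK (s : ℕ) where
  d : Fin s → ℝ
  θ : ℝ
  Ahat : Matrix (Fin s) (Fin s) ℝ
  A : Matrix (Fin s) (Fin s) ℝ
  bhat : Fin s → ℝ
  b : Fin s → ℝ

namespace TSRK

variable {s : ℕ}

/-- Right-hand side of the equation of stage `i`, for the values `uPrev = u^{n-1}`, `u = u^n`,
`yPrev = y^{n-1}`, `y = y^n` and the step size `h`. -/
def stageRHS (M : TSRK s) {V : Type*} [AddCommGroup V] [Module ℝ V] (F : V → V) (h : ℝ)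
    (uPrev u : V) (yPrev y : Fin s → V) (i : Fin s) : V :=
  M.d i • uPrev + (1 - M.d i) • u + h • ∑ j, M.Ahat i j • F (yPrev j)
    + h • ∑ j, M.A i j • F (y j)

/-- The new value `u^{n+1}`. -/
def output (M : TSRK s) {V : Type*} [AddCommGroup V] [Module ℝ V] (F : V → V) (h : ℝ)
    (uPrev u : V) (yPrev y : Fin s → V) : V :=
  M.θ • uPrev + (1 - M.θ) • u + h • ∑ j, M.bhat j • F (yPrev j) + h • ∑ j, M.b j • F (y j)

/-- Stage `i` is identically equal to `u^n`. -/
def StageIsCurrent (M : TSRK s) (i : Fin s) : Prop :=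
  M.d i = 0 ∧ (∀ j, M.A i j = 0) ∧ (∀ j, M.Ahat i j = 0)

/-- Stage `i` is identically equal to `u^{n-1}`. -/
def StageIsPrevious (M : TSRK s) (i : Fin s) : Prop :=
  M.d i = 1 ∧ (∀ j, M.A i j = 0) ∧ (∀ j, M.Ahat i j = 0)

/-- HS-reducibility: two of the values at which `F` is evaluated are identically equal. Either two
stages of the current step coincide, or some stage is `u^n` (so that `u^{n-1}` is a stage of the
previous step) while another stage of the current step is again `u^{n-1}`. -/
def HSReducible (M : TSRK s) : Prop :=
  (∃ i j, i ≠ j ∧ M.d i = M.d j ∧ (∀ l, M.A i l = M.A j l) ∧ (∀ l, M.Ahat i l = M.Ahat j l)) ∨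
  ((∃ i, M.StageIsCurrent i) ∧ (∃ i, M.StageIsPrevious i))

/-- DJ-reducibility: there is a nonempty set of stages that do not affect the output. -/
def DJReducible (M : TSRK s) : Prop :=
  ∃ S : Set (Fin s), S.Nonempty ∧ (∀ j ∈ S, M.b j = 0 ∧ M.bhat j = 0) ∧
    ∀ i, i ∉ S → ∀ j ∈ S, M.A i j = 0 ∧ M.Ahat i j = 0

/-- Irreducible: neither HS-reducible nor DJ-reducible. -/
def Irreducible (M : TSRK s) : Prop :=
  ¬ M.HSReducible ∧ ¬ M.DJReducible

/-- Strong stability preservation with constant `C`: for every right-hand side `F` on some `ℝ^N`,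
every convex functional `φ` and every `τ > 0` such that forward Euler does not increase `φ` for
step sizes in `[0, τ]`, a step of the method of size `0 < h ≤ C * τ` gives an output on which `φ`
does not exceed its maximum over the inputs `u^{n-1}`, `u^n`, `y^{n-1}`. The inputs are arbitrary,
except that a stage that is identically equal to `u^n` has the value `u^{n-1}` in the previous
step. -/
def IsSSPWith (M : TSRK s) (C : ℝ≥0) : Prop :=
  ∀ (N : ℕ) (F : (Fin N → ℝ) → (Fin N → ℝ)) (φ : (Fin N → ℝ) → ℝ) (τ : ℝ),
    ConvexOn ℝ Set.univ φ → 0 < τ →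
    (∀ v, ∀ σ : ℝ, 0 ≤ σ → σ ≤ τ → φ (v + σ • F v) ≤ φ v) →
    ∀ h : ℝ, 0 < h → h ≤ C * τ →
    ∀ (uPrev u : Fin N → ℝ) (yPrev y : Fin s → Fin N → ℝ),
      (∀ i, M.StageIsCurrent i → yPrev i = uPrev) →
      (∀ i, y i = M.stageRHS F h uPrev u yPrev y i) →
      ∀ B : ℝ, φ uPrev ≤ B → φ u ≤ B → (∀ i, φ (yPrev i) ≤ B) →
        φ (M.output F h uPrev u yPrev y) ≤ B

/-- The SSP coefficient (the supremum of the admissible constants; it may be infinite, and it is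
`0` if no positive constant is admissible). -/
def sspCoeff (M : TSRK s) : ℝ≥0∞ :=
  ⨆ (C : ℝ≥0) (_ : M.IsSSPWith C), (C : ℝ≥0∞)

/-- Order (at least) `p`: for every smooth autonomous system `u' = F(u)` and every solution `w`
near `t`, one step from the exact values `w (t - h)` and `w t` has local error `O(h^(p+1))`.
The stages `Y h m` of the step at `t - m h` solve the stage equations with exact values of `w`
for `m = 0, …, p`; going back that far makes the result independent, up to `o(h^(p+1))`, of the
choice of the remaining starting stages `Y h (p+1)`. -/
def HasOrder (M : TSRK s) (p : ℕ) : Prop :=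
  ∀ (N : ℕ) (F : (Fin N → ℝ) → (Fin N → ℝ)) (w : ℝ → (Fin N → ℝ)) (t : ℝ),
    ContDiff ℝ (⊤ : ℕ∞) F →
    (∀ᶠ r in 𝓝 t, HasDerivAt w (F (w r)) r) →
    ∀ Y : ℝ → ℕ → Fin s → (Fin N → ℝ),
      (∀ m ≤ p + 1, ∀ i, Tendsto (fun h => Y h m i) (𝓝[>] 0) (𝓝 (w t))) →
      (∀ᶠ h in 𝓝[>] (0 : ℝ), ∀ m ≤ p, ∀ i,
        Y h m i = M.stageRHS F h (w (t - (m + 1) * h)) (w (t - m * h)) (Y h (m + 1)) (Y h m) i) →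
      (fun h : ℝ => w (t + h) - M.output F h (w (t - h)) (w t) (Y h 1) (Y h 0))
        =O[𝓝[>] (0 : ℝ)] (fun h : ℝ => h ^ (p + 1))

/-- The abscissae: `y_i^n` approximates the solution at `t_n + c_i Δt`. -/
def c (M : TSRK s) (i : Fin s) : ℝ :=
  ∑ j, M.A i j + ∑ j, M.Ahat i j - M.d i

/-- The coefficient of `Δt^(k-1) u^(k)(t_n)` (`k ≥ 1`) in the truncation error of stage `i`. -/
def stageTruncation (M : TSRK s) (k : ℕ) (i : Fin s) : ℝ :=
  (M.c i ^ k - (-1) ^ k * M.d i) / (k.factorial : ℝ)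
    - (∑ j, M.A i j * M.c j ^ (k - 1) + ∑ j, M.Ahat i j * (M.c j - 1) ^ (k - 1))
        / ((k - 1).factorial : ℝ)

/-- Stage order at least `q`. -/
def HasStageOrder (M : TSRK s) (q : ℕ) : Prop :=
  ∀ k, 1 ≤ k → k ≤ q → ∀ i, M.stageTruncation k i = 0

end TSRK

end

namespace TSRK

variable {s : ℕ}

/-! Stage errors can be squared by a smooth right-hand side. The quadrature system with exact
component `r ^ k / k!`, extended by an equation driven by the squared defect, has local error `-h ^
(2 * k + 1) * ∑ j, b j * τ_{k,j} ^ 2`, provided `bhat` acts only on previous stages equal to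
`u^{n-1}`, which are exact. If `2 * k + 1 ≤ p`, the sum vanishes, and positive weights then force
every `τ_{k,j} = 0`.

Both facts about the weights come from monotonicity (`bhat_eq_zero`, `b_pos`). Without
HS-reducibility the values of `F` at the stages can be chosen independently (`output_le_of_values`),
so a wrong sign or an unwanted dependence gives a counterexample for a simple convex functional.
Stages equal to `u^n` need no weight condition: their truncation errors vanish. -/

/-! ### Prescribing the values of `F` at the stages -/

theorem map_stageRHS (M : TSRK s) {V W : Type*} [AddCommGroup V] [Module ℝ V] [AddCommGroup W]
    [Module ℝ W] (e : V ≃ₗ[ℝ] W) (F : V → V) (h : ℝ) (uPrev u : V) (yPrev y : Fin s → V)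
    (i : Fin s) :
    M.stageRHS (fun v => e (F (e.symm v))) h (e uPrev) (e u) (fun j => e (yPrev j))
      (fun j => e (y j)) i = e (M.stageRHS F h uPrev u yPrev y i) := by
  simp [stageRHS]

theorem map_output (M : TSRK s) {V W : Type*} [AddCommGroup V] [Module ℝ V] [AddCommGroup W]
    [Module ℝ W] (e : V ≃ₗ[ℝ] W) (F : V → V) (h : ℝ) (uPrev u : V) (yPrev y : Fin s → V) :
    M.output (fun v => e (F (e.symm v))) h (e uPrev) (e u) (fun j => e (yPrev j))
      (fun j => e (y j)) = e (M.output F h uPrev u yPrev y) := by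
  simp [output]

/-- Strong stability preservation on an arbitrary finite-dimensional space. -/
theorem IsSSPWith.of_finiteDimensional {M : TSRK s} {C : ℝ≥0} (hM : M.IsSSPWith C)
    {V : Type*} [AddCommGroup V] [Module ℝ V] [FiniteDimensional ℝ V]
    {F : V → V} {φ : V → ℝ} {τ : ℝ} (hφ : ConvexOn ℝ Set.univ φ) (hτ : 0 < τ)
    (hF : ∀ v, ∀ σ : ℝ, 0 ≤ σ → σ ≤ τ → φ (v + σ • F v) ≤ φ v)
    {h : ℝ} (h0 : 0 < h) (hC : h ≤ C * τ) {uPrev u : V} {yPrev y : Fin s → V}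
    (hcur : ∀ i, M.StageIsCurrent i → yPrev i = uPrev)
    (hy : ∀ i, y i = M.stageRHS F h uPrev u yPrev y i)
    {B : ℝ} (hBp : φ uPrev ≤ B) (hB : φ u ≤ B) (hBy : ∀ i, φ (yPrev i) ≤ B) :
    φ (M.output F h uPrev u yPrev y) ≤ B := by
  let e := (Module.finBasis ℝ V).equivFun
  have key := hM _ (fun v => e (F (e.symm v))) (fun v => φ (e.symm v)) τ
    (hφ.comp_linearMap e.symm.toLinearMap) hτ
    (fun v σ h1 h2 => by simpa using hF (e.symm v) σ h1 h2) h h0 hC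
    (e uPrev) (e u) (fun j => e (yPrev j)) (fun j => e (y j))
    (fun i hi => by simp only [hcur i hi])
    (fun i => by rw [map_stageRHS, ← hy]) B (by simpa using hBp) (by simpa using hB)
    (fun i => by simpa using hBy i)
  rw [map_output] at key
  simpa using key

/-- Appended coordinates that keep the stage values apart. -/
abbrev Tag (s : ℕ) : Type := ℝ × (Fin s → ℝ) × (Fin s → ℝ) × (Fin s → ℝ)

/-- For a method that is not HS-reducible, the values of the right-hand side at the stages can be
prescribed independently of each other. -/
theorem IsSSPWith.output_le_of_values {M : TSRK s} {C : ℝ≥0} (hM : M.IsSSPWith C)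
    (hHS : ¬ M.HSReducible)
    {V : Type*} [AddCommGroup V] [Module ℝ V] [FiniteDimensional ℝ V]
    {φ : V → ℝ} (hφ : ConvexOn ℝ Set.univ φ) {h : ℝ} (h0 : 0 < h) (hC : h ≤ C)
    {uPrev u : V} {yPrev y g f : Fin s → V}
    (hcur : ∀ i, M.StageIsCurrent i → yPrev i = uPrev)
    (hy : ∀ i, y i = M.d i • uPrev + (1 - M.d i) • u + h • ∑ j, M.Ahat i j • g j
      + h • ∑ j, M.A i j • f j)
    (hg : ∀ i, ∀ σ : ℝ, 0 ≤ σ → σ ≤ 1 → φ (yPrev i + σ • g i) ≤ φ (yPrev i))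
    (hf : ∀ i, ∀ σ : ℝ, 0 ≤ σ → σ ≤ 1 → φ (y i + σ • f i) ≤ φ (y i))
    {B : ℝ} (hBp : φ uPrev ≤ B) (hB : φ u ≤ B) (hBy : ∀ i, φ (yPrev i) ≤ B) :
    φ (M.θ • uPrev + (1 - M.θ) • u + h • ∑ j, M.bhat j • g j + h • ∑ j, M.b j • f j) ≤ B := by
  classical
  -- With `u^{n-1}` tagged `(1, 0, 0, 0)` and `u^n` tagged `0`, the tag of a current stage records
  -- its row of coefficients. Unconstrained previous stages get private coordinates.
  let tagPrev : Fin s → Tag s := fun i =>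
    if M.StageIsCurrent i then (1, 0, 0, 0) else (0, 0, 0, Pi.single i 1)
  let tag : Fin s → Tag s := fun i => (M.d i, h • M.Ahat i, h • M.A i, 0)
  let pt : Fin s ⊕ Fin s → V × Tag s :=
    Sum.elim (fun i => (yPrev i, tagPrev i)) (fun i => (y i, tag i))
  let val : Fin s ⊕ Fin s → V × Tag s :=
    Sum.elim (fun i => (g i, (0, Pi.single i 1, 0, 0))) (fun i => (f i, (0, 0, Pi.single i 1, 0)))
  have hne : ∀ i j, M.d i = M.d j → (∀ l, M.A i l = M.A j l) → (∀ l, M.Ahat i l = M.Ahat j l) →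
      i = j := fun i j h1 h2 h3 => by
    by_contra hij
    exact hHS (Or.inl ⟨i, j, hij, h1, h2, h3⟩)
  have hsingle : ∀ i j : Fin s, (Pi.single i 1 : Fin s → ℝ) = Pi.single j 1 → i = j := by
    intro i j hij
    by_contra hne
    have := congrFun hij i
    simp [Pi.single_eq_of_ne hne] at this
  have hpt_cross : ∀ i j, tagPrev i ≠ tag j := by
    intro i j hij
    by_cases hi : M.StageIsCurrent i
    · simp only [tagPrev, tag, hi, if_true, Prod.mk.injEq] at hij
      obtain ⟨h1, h2, h3, -⟩ := hij
      -- This collision is the second kind of HS-reducibility: `u^{n-1}` occurs both as a previous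
      -- and as a current stage.
      refine hHS (Or.inr ⟨⟨i, hi⟩, j, h1.symm, fun l => ?_, fun l => ?_⟩)
      · simpa [h0.ne'] using (congrFun h3 l).symm
      · simpa [h0.ne'] using (congrFun h2 l).symm
    · simp only [tagPrev, tag, hi, if_false, Prod.mk.injEq] at hij
      simpa using congrFun hij.2.2.2 i
  have hpt : Function.Injective pt := by
    rintro (i | i) (j | j) hij
    · replace hij : tagPrev i = tagPrev j := congrArg Prod.snd hij
      congr 1
      by_cases hi : M.StageIsCurrent i <;> by_cases hj : M.StageIsCurrent j
      · exact hne i j (hi.1.trans hj.1.symm) (fun l => (hi.2.1 l).trans (hj.2.1 l).symm)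
          (fun l => (hi.2.2 l).trans (hj.2.2 l).symm)
      · simp [tagPrev, hi, hj] at hij
      · simp [tagPrev, hi, hj] at hij
      · simp only [tagPrev, hi, hj, if_false, Prod.mk.injEq, true_and] at hij
        exact hsingle i j hij
    · exact (hpt_cross i j (congrArg Prod.snd hij)).elim
    · exact (hpt_cross j i (congrArg Prod.snd hij).symm).elim
    · replace hij : tag i = tag j := congrArg Prod.snd hij
      congr 1
      simp only [tag, Prod.mk.injEq, and_true] at hij
      refine hne i j hij.1 (fun l => ?_) (fun l => ?_)
      · simpa [h0.ne'] using congrFun hij.2.2 l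
      · simpa [h0.ne'] using congrFun hij.2.1 l
  -- Away from the stage points `F` is zero, so forward Euler is trivially monotone there; no
  -- continuity of `F` is required.
  let F : V × Tag s → V × Tag s := Function.extend pt val 0
  have hFg : ∀ i, F (yPrev i, tagPrev i) = val (Sum.inl i) := fun i =>
    hpt.extend_apply val 0 (Sum.inl i)
  have hFf : ∀ i, F (y i, tag i) = val (Sum.inr i) := fun i =>
    hpt.extend_apply val 0 (Sum.inr i)
  have hsumsingle : ∀ a : Fin s → ℝ,
      ∑ j, a j • (Pi.single j 1 : Fin s → ℝ) = a := fun a => by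
    ext l
    simp [Finset.sum_apply, Pi.single_apply]
  have key := hM.of_finiteDimensional (V := V × Tag s) (F := F) (φ := fun v => φ v.1) (τ := 1)
    (hφ.comp_linearMap (LinearMap.fst ℝ V (Tag s))) one_pos
    (fun v σ h1 h2 => by
      by_cases hv : ∃ a, pt a = v
      · obtain ⟨a, rfl⟩ := hv
        rw [show F (pt a) = val a from hpt.extend_apply val 0 a]
        rcases a with i | i
        · exact hg i σ h1 h2
        · exact hf i σ h1 h2
      · rw [show F v = 0 from Function.extend_apply' val (0 : V × Tag s → V × Tag s) v hv]
        simp)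
    h0 (by simpa using hC) (uPrev := ((uPrev, (1, 0, 0, 0)) : V × Tag s))
    (u := ((u, 0) : V × Tag s))
    (yPrev := fun i => (yPrev i, tagPrev i)) (y := fun i => (y i, tag i))
    (fun i hi => by simp [hcur i hi, tagPrev, hi])
    (fun i => by
      simp only [stageRHS, hFg, hFf]
      refine Prod.ext ?_ (Prod.ext ?_ (Prod.ext ?_ (Prod.ext ?_ ?_)))
      · simp [val, Prod.fst_sum, hy i]
      · simp [val, tag, Prod.fst_sum, Prod.snd_sum]
      · simp [val, tag, Prod.fst_sum, Prod.snd_sum, hsumsingle]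
      · simp [val, tag, Prod.fst_sum, Prod.snd_sum, hsumsingle]
      · simp [val, tag, Prod.snd_sum])
    (B := B) hBp hB hBy
  simpa [output, hFg, hFf, val, Prod.fst_sum] using key

/-! ### Signs and zeros of the coefficients -/

theorem convexOn_max_fst_snd :
    ConvexOn ℝ Set.univ (fun v : ℝ × ℝ => max v.1 v.2) :=
  ((LinearMap.fst ℝ ℝ ℝ).convexOn convex_univ).sup ((LinearMap.snd ℝ ℝ ℝ).convexOn convex_univ)

section Positivity

variable {M : TSRK s} {C : ℝ≥0}

theorem IsSSPWith.b_nonneg (hM : M.IsSSPWith C) (hC : 0 < C) (hHS : ¬ M.HSReducible)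
    (j : Fin s) : 0 ≤ M.b j := by
  have h0 : (0 : ℝ) < C := hC
  have key := hM.output_le_of_values hHS (φ := fun v : ℝ => v)
    (LinearMap.id.convexOn convex_univ) h0 le_rfl (uPrev := 0) (u := 0) (yPrev := 0)
    (g := 0) (f := Pi.single j (-1)) (fun _ _ => rfl) (fun _ => rfl) (by simp)
    (fun i σ h1 _ => by
      rcases eq_or_ne i j with rfl | hij
      · simp [h1]
      · simp [Pi.single_eq_of_ne hij])
    (B := 0) le_rfl le_rfl (fun _ => le_rfl)
  simpa [Pi.single_apply, h0] using key

/-- Such a previous stage is a free input. Placed at `-1`, strictly inside the flat region of `max v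
0`, it admits values of `F` of either sign. -/
theorem IsSSPWith.bhat_eq_zero (hM : M.IsSSPWith C) (hC : 0 < C) (hHS : ¬ M.HSReducible)
    {j : Fin s} (hj : ¬ M.StageIsCurrent j) : M.bhat j = 0 := by
  have h0 : (0 : ℝ) < C := hC
  have key : ∀ ε : ℝ, ε ≤ 1 → M.bhat j * ε ≤ 0 := by
    intro ε hε
    have key := hM.output_le_of_values hHS (φ := fun v : ℝ => max v 0)
      ((LinearMap.id.convexOn convex_univ).sup (convexOn_const 0 convex_univ)) h0 le_rfl
      (uPrev := 0) (u := 0) (yPrev := Pi.single j (-1)) (g := Pi.single j ε) (f := 0)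
      (fun i hi => Pi.single_eq_of_ne (by rintro rfl; exact hj hi) _) (fun _ => rfl)
      (fun i σ h1 h2 => by
        rcases eq_or_ne i j with rfl | hij
        · have : σ * ε ≤ 1 := by nlinarith
          simpa using this
        · simp [Pi.single_eq_of_ne hij])
      (by simp) (B := 0) (by simp) (by simp)
      (fun i => by
        rcases eq_or_ne i j with rfl | hij
        · simp
        · simp [Pi.single_eq_of_ne hij])
    have key' : (C : ℝ) * (M.bhat j * ε) ≤ 0 := by
      simpa [Pi.single_apply] using key
    exact nonpos_of_mul_nonpos_right key' h0
  linarith [key 1 le_rfl, key (-1) (by norm_num)]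

theorem max_add_smul_le_of_nonpos (y v : ℝ × ℝ) (h1 : v.1 ≤ 0) (h2 : v.2 ≤ 0) {σ : ℝ}
    (hσ : 0 ≤ σ) : max (y + σ • v).1 (y + σ • v).2 ≤ max y.1 y.2 :=
  max_le_max (by simpa using mul_nonpos_of_nonneg_of_nonpos hσ h1)
    (by simpa using mul_nonpos_of_nonneg_of_nonpos hσ h2)

theorem max_add_smul_le_of_snd_add_le (y : ℝ × ℝ) {ε σ : ℝ} (hε : 0 ≤ ε) (h : y.2 + ε ≤ y.1)
    (hσ : σ ≤ 1) : max (y + σ • ((0, ε) : ℝ × ℝ)).1 (y + σ • ((0, ε) : ℝ × ℝ)).2 ≤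
      max y.1 y.2 := by
  have : σ * ε ≤ ε := mul_le_of_le_one_left hε hσ
  simp only [Prod.fst_add, Prod.snd_add, Prod.smul_fst, Prod.smul_snd, smul_eq_mul, mul_zero,
    add_zero]
  exact max_le (le_max_left _ _) (le_max_of_le_left (by linarith))

/-- A nonzero coefficient `α` allows a nonpositive perturbation that makes an increase of the
second coordinate admissible for `max`. -/
theorem exists_perturbation {α h : ℝ} (hα : α ≠ 0) (h0 : 0 < h) (β : ℝ) :
    ∃ (v : ℝ × ℝ) (ε : ℝ), v.1 ≤ 0 ∧ v.2 ≤ 0 ∧ 0 < ε ∧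
      h * (α * v.2) + h * (β * ε) + ε ≤ h * (α * v.1) := by
  have hden : 0 < 1 + h * |β| := by positivity
  -- The vector `v` opens a gap `h * |α|` between the coordinates; this `ε` fits into it even after
  -- the feedback `β` of the stage on itself.
  have hε : 0 < h * |α| / (1 + h * |β|) := by positivity
  have hle : h * (β * (h * |α| / (1 + h * |β|))) + h * |α| / (1 + h * |β|) ≤ h * |α| := by
    have hβ : h * β ≤ h * |β| := by gcongr; exact le_abs_self β
    calc _ = (1 + h * β) * (h * |α| / (1 + h * |β|)) := by ring
      _ ≤ (1 + h * |β|) * (h * |α| / (1 + h * |β|)) := by gcongr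
      _ = h * |α| := by field_simp
  rcases hα.lt_or_gt with hneg | hpos
  · refine ⟨(-1, 0), _, by simp, le_rfl, hε, ?_⟩
    rw [abs_of_neg hneg] at hle ⊢
    linarith
  · refine ⟨(0, -1), _, le_rfl, by simp, hε, ?_⟩
    rw [abs_of_pos hpos] at hle ⊢
    linarith

/-- A stage with positive weight depends only on stages with nonzero weight. -/
theorem IsSSPWith.A_eq_zero (hM : M.IsSSPWith C) (hC : 0 < C) (hHS : ¬ M.HSReducible)
    {i j : Fin s} (hi : 0 < M.b i) (hj : M.b j = 0) : M.A i j = 0 := by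
  by_contra ha
  have h0 : (0 : ℝ) < C := hC
  have hij : i ≠ j := by rintro rfl; exact hi.ne' hj
  obtain ⟨v, ε, hv1, hv2, hε, hle⟩ := exists_perturbation ha h0 (M.A i i)
  -- Stage `j` lowers the second coordinate of stage `i` relative to the first, so `F` may increase
  -- it there. As `b j = 0`, the output sees only this increase `h * b i * ε > 0`.
  have key := hM.output_le_of_values hHS convexOn_max_fst_snd h0 le_rfl
    (uPrev := 0) (u := 0) (yPrev := 0) (g := 0) (f := Pi.single i (0, ε) + Pi.single j v)
    (fun _ _ => rfl) (fun _ => rfl) (by simp)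
    (fun l σ h1 h2 => by
      rcases eq_or_ne l i with rfl | hl
      · rw [Pi.add_apply, Pi.single_eq_same, Pi.single_eq_of_ne hij, add_zero]
        refine max_add_smul_le_of_snd_add_le _ hε.le ?_ h2
        simp [Pi.single_apply, smul_add, Finset.sum_add_distrib]
        linarith
      · rw [Pi.add_apply, Pi.single_eq_of_ne hl, zero_add]
        rcases eq_or_ne l j with rfl | hl'
        · rw [Pi.single_eq_same]
          exact max_add_smul_le_of_nonpos _ _ hv1 hv2 h1
        · simp [Pi.single_eq_of_ne hl'])
    (B := 0) (by simp) (by simp) (by simp)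
  simp [Pi.single_apply, smul_add, Finset.sum_add_distrib, hj] at key
  have := mul_pos h0 (mul_pos hi hε)
  linarith

/-- A stage with positive weight uses no previous stage other than `u^{n-1}`. -/
theorem IsSSPWith.Ahat_eq_zero (hM : M.IsSSPWith C) (hC : 0 < C) (hHS : ¬ M.HSReducible)
    {i j : Fin s} (hi : 0 < M.b i) (hj : ¬ M.StageIsCurrent j) : M.Ahat i j = 0 := by
  by_contra ha
  have h0 : (0 : ℝ) < C := hC
  have hbj := hM.bhat_eq_zero hC hHS hj
  obtain ⟨v, ε, hv1, hv2, hε, hle⟩ := exists_perturbation ha h0 (M.A i i)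
  have key := hM.output_le_of_values hHS convexOn_max_fst_snd h0 le_rfl
    (uPrev := 0) (u := 0) (yPrev := 0) (g := Pi.single j v) (f := Pi.single i (0, ε))
    (fun _ _ => rfl) (fun _ => rfl)
    (fun l σ h1 _ => by
      rcases eq_or_ne l j with rfl | hl
      · rw [Pi.single_eq_same]
        exact max_add_smul_le_of_nonpos _ _ hv1 hv2 h1
      · simp [Pi.single_eq_of_ne hl])
    (fun l σ _ h2 => by
      rcases eq_or_ne l i with rfl | hl
      · rw [Pi.single_eq_same]
        refine max_add_smul_le_of_snd_add_le _ hε.le ?_ h2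
        simp [Pi.single_apply]
        linarith
      · simp [Pi.single_eq_of_ne hl])
    (B := 0) (by simp) (by simp) (by simp)
  simp [Pi.single_apply, hbj] at key
  have := mul_pos h0 (mul_pos hi hε)
  linarith

/-- Otherwise the zero-weight stages other than `u^n` form a DJ-reducing set: no stage outside it
depends on it. -/
theorem IsSSPWith.b_pos (hM : M.IsSSPWith C) (hC : 0 < C) (hirr : M.Irreducible)
    {j : Fin s} (hj : ¬ M.StageIsCurrent j) : 0 < M.b j := by
  refine (hM.b_nonneg hC hirr.1 j).lt_of_ne' fun hbj => hirr.2
    ⟨{l | M.b l = 0 ∧ ¬ M.StageIsCurrent l}, ⟨j, hbj, hj⟩,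
      fun l hl => ⟨hl.1, hM.bhat_eq_zero hC hirr.1 hl.2⟩, fun i hi l hl => ?_⟩
  by_cases hcur : M.StageIsCurrent i
  · exact ⟨hcur.2.1 l, hcur.2.2 l⟩
  · have hbi : 0 < M.b i :=
      (hM.b_nonneg hC hirr.1 i).lt_of_ne' fun h => hi ⟨h, hcur⟩
    exact ⟨hM.A_eq_zero hC hirr.1 hbi hl.1, hM.Ahat_eq_zero hC hirr.1 hbi hl.2⟩

end Positivity

/-! ### Order condition on the squared stage errors -/

theorem StageIsCurrent.stageTruncation_eq_zero {M : TSRK s} {i : Fin s}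
    (hi : M.StageIsCurrent i) {k : ℕ} (hk : 1 ≤ k) : M.stageTruncation k i = 0 := by
  have hk' : k ≠ 0 := by omega
  simp [stageTruncation, c, hi.1, hi.2.1, hi.2.2, hk']

theorem exists_isSSPWith_of_sspCoeff_pos {M : TSRK s} (hM : 0 < M.sspCoeff) :
    ∃ C : ℝ≥0, 0 < C ∧ M.IsSSPWith C := by
  simp only [sspCoeff, lt_iSup_iff] at hM
  obtain ⟨C, hC, h⟩ := hM
  exact ⟨C, by simpa using h, hC⟩

theorem stageRHS_apply (M : TSRK s) {ι : Type*} (F : (ι → ℝ) → (ι → ℝ)) (h : ℝ) (uPrev u : ι → ℝ)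
    (yPrev y : Fin s → ι → ℝ) (i : Fin s) (l : ι) :
    M.stageRHS F h uPrev u yPrev y i l = M.d i * uPrev l + (1 - M.d i) * u l
      + h * ∑ j, M.Ahat i j * F (yPrev j) l + h * ∑ j, M.A i j * F (y j) l := by
  simp [stageRHS]

theorem output_apply (M : TSRK s) {ι : Type*} (F : (ι → ℝ) → (ι → ℝ)) (h : ℝ) (uPrev u : ι → ℝ)
    (yPrev y : Fin s → ι → ℝ) (l : ι) :
    M.output F h uPrev u yPrev y l = M.θ * uPrev l + (1 - M.θ) * u l
      + h * ∑ j, M.bhat j * F (yPrev j) l + h * ∑ j, M.b j * F (y j) l := by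
  simp [output]

/-- If only stages equal to `u^{n-1}` enter the output with a previous value, the squares of the
stage errors enter the local error with the weights `b`. -/
theorem HasOrder.sum_b_mul_stageTruncation_sq {M : TSRK s} {p k : ℕ} (hM : M.HasOrder p)
    (hk : 1 ≤ k) (hkp : 2 * k + 1 ≤ p) (hbhat : ∀ j, ¬ M.StageIsCurrent j → M.bhat j = 0) :
    ∑ j, M.b j * M.stageTruncation k j ^ 2 = 0 := by
  obtain ⟨n, rfl⟩ : ∃ n, k = n + 1 := ⟨k - 1, by omega⟩
  -- The components are time, a quadrature, and the squared defect between them, which is zero on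
  -- the exact solution. The system is triangular, so even implicit stages are explicit: `T`, `X`,
  -- `Z`.
  let F : (Fin 3 → ℝ) → (Fin 3 → ℝ) := fun v =>
    ![1, v 0 ^ n / n.factorial, (v 1 - v 0 ^ (n + 1) / (n + 1).factorial) ^ 2]
  let w : ℝ → (Fin 3 → ℝ) := fun r => ![r, r ^ (n + 1) / (n + 1).factorial, 0]
  let T : ℝ → ℕ → Fin s → ℝ := fun h m i => (M.c i - m) * h
  let X : ℝ → ℕ → Fin s → ℝ := fun h m i =>
    M.d i * ((-((m + 1) * h)) ^ (n + 1) / (n + 1).factorial)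
      + (1 - M.d i) * ((-(m * h)) ^ (n + 1) / (n + 1).factorial)
      + h * ∑ j, M.Ahat i j * (T h (m + 1) j ^ n / n.factorial)
      + h * ∑ j, M.A i j * (T h m j ^ n / n.factorial)
  let E : ℝ → ℕ → Fin s → ℝ := fun h m i => X h m i - T h m i ^ (n + 1) / (n + 1).factorial
  let Z : ℝ → ℕ → Fin s → ℝ := fun h m i =>
    h * ∑ j, M.Ahat i j * E h (m + 1) j ^ 2 + h * ∑ j, M.A i j * E h m j ^ 2
  let Y : ℝ → ℕ → Fin s → (Fin 3 → ℝ) := fun h m i => ![T h m i, X h m i, Z h m i]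
  have hstage : ∀ h m i, Y h m i =
      M.stageRHS F h (w (0 - (m + 1) * h)) (w (0 - m * h)) (Y h (m + 1)) (Y h m) i := by
    intro h m i
    ext l
    fin_cases l
    · simp [stageRHS_apply, Y, w, F, T, c]
      ring
    · simp [stageRHS_apply, Y, w, F, X]
    · simp [stageRHS_apply, Y, w, F, Z, E]
  have hE : ∀ h i, E h 0 i = -(h ^ (n + 1) * M.stageTruncation (n + 1) i) := by
    intro h i
    have h1 : ∑ j, M.Ahat i j * (T h (0 + 1) j ^ n / n.factorial) =
        h ^ n / n.factorial * ∑ j, M.Ahat i j * (M.c j - 1) ^ n := by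
      rw [Finset.mul_sum]
      refine Finset.sum_congr rfl fun j _ => ?_
      simp only [T, mul_pow]
      push_cast
      ring
    have h2 : ∑ j, M.A i j * (T h 0 j ^ n / n.factorial) =
        h ^ n / n.factorial * ∑ j, M.A i j * M.c j ^ n := by
      rw [Finset.mul_sum]
      refine Finset.sum_congr rfl fun j _ => ?_
      simp only [T, mul_pow]
      push_cast
      ring
    simp only [E, X]
    rw [h1, h2]
    simp only [stageTruncation, Nat.add_sub_cancel, T, mul_pow]
    rw [show (-(((0 : ℕ) + 1 : ℝ) * h)) = (-1) * h by push_cast; ring, mul_pow]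
    simp
    ring
  have hprev : ∀ h i, M.StageIsCurrent i → E h 1 i = 0 := by
    intro h i hi
    simp [E, X, T, hi.1, hi.2.1, hi.2.2, c]
  have herr : ∀ h, (w (0 + h) - M.output F h (w (0 - h)) (w 0) (Y h 1) (Y h 0)) 2 =
      -(∑ j, M.b j * M.stageTruncation (n + 1) j ^ 2) * h ^ (2 * (n + 1) + 1) := by
    intro h
    have h1 : ∑ j, M.bhat j * E h 1 j ^ 2 = 0 := Finset.sum_eq_zero fun j _ => by
      by_cases hj : M.StageIsCurrent j
      · simp [hprev h j hj]
      · simp [hbhat j hj]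
    have h2 : ∑ j, M.b j * E h 0 j ^ 2 =
        h ^ (2 * (n + 1)) * ∑ j, M.b j * M.stageTruncation (n + 1) j ^ 2 := by
      rw [Finset.mul_sum]
      refine Finset.sum_congr rfl fun j _ => ?_
      rw [hE]
      ring
    have h3 : (w (0 + h) - M.output F h (w (0 - h)) (w 0) (Y h 1) (Y h 0)) 2 =
        -(h * ∑ j, M.bhat j * E h 1 j ^ 2 + h * ∑ j, M.b j * E h 0 j ^ 2) := by
      rw [Pi.sub_apply, output_apply]
      simp [w, F, Y, E]
    rw [h3, h1, h2]
    ring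
  have hcont : ∀ m i, Continuous fun h => Y h m i := by
    intro m i
    refine continuous_pi fun l => ?_
    fin_cases l
    · simp [Y, T]
      fun_prop
    · simp [Y, X, T]
      fun_prop
    · simp [Y, Z, E, X, T]
      fun_prop
  have hbig := hM 3 F w 0
    (contDiff_pi.2 fun l => by
      fin_cases l
      · simpa [F] using contDiff_const
      · simp [F]
        fun_prop
      · simp [F]
        fun_prop)
    (Eventually.of_forall fun r => hasDerivAt_pi.2 fun l => by
      fin_cases l
      · simpa [F, w] using hasDerivAt_id' r
      · have := (hasDerivAt_pow (n + 1) r).div_const ((n + 1).factorial : ℝ)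
        have h1 : F (w r) 1 = ((n + 1 : ℕ) * r ^ (n + 1 - 1)) / ((n + 1).factorial : ℝ) := by
          simp [F, w, Nat.factorial_succ]
          field_simp
        exact h1 ▸ this
      · simpa [F, w] using hasDerivAt_const r (0 : ℝ))
    Y
    (fun m _ i => by
      have h0 : Y 0 m i = w 0 := by
        ext l
        fin_cases l <;> simp [Y, w, T, X, Z]
      rw [← h0]
      exact (hcont m i).continuousAt.tendsto.mono_left nhdsWithin_le_nhds)
    (Eventually.of_forall fun h m _ i => hstage h m i)
  have hbig2 := (isBigO_pi.1 hbig) 2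
  simp only [herr] at hbig2
  by_contra hS
  -- Since `2 * k + 1 < p + 1`, a nonzero sum would make `h ^ (2 * k + 1)` negligible against
  -- itself.
  have hlit : (fun h : ℝ => h ^ (p + 1)) =o[𝓝[>] 0] fun h : ℝ => h ^ (2 * (n + 1) + 1) :=
    (isLittleO_pow_pow (by omega)).mono nhdsWithin_le_nhds
  have hself := (isLittleO_const_mul_left_iff (neg_ne_zero.2 hS)).1 (hbig2.trans_isLittleO hlit)
  refine isLittleO_irrefl (Eventually.frequently ?_) hself
  filter_upwards [self_mem_nhdsWithin] with h hh
  exact pow_ne_zero _ (ne_of_gt hh)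

end TSRK

theorem theorem3 {s : ℕ} (M : TSRK s) (p : ℕ) (hirr : M.Irreducible)
    (hssp : 0 < M.sspCoeff) (hord : M.HasOrder p) :
    M.HasStageOrder ((p - 1) / 2) := by
  obtain ⟨C, hC, hM⟩ := TSRK.exists_isSSPWith_of_sspCoeff_pos hssp
  intro k hk hkq i
  by_cases hi : M.StageIsCurrent i
  · exact hi.stageTruncation_eq_zero hk
  have hsum := hord.sum_b_mul_stageTruncation_sq hk (by omega)
    fun j hj => hM.bhat_eq_zero hC hirr.1 hj
  have h0 := (Finset.sum_eq_zero_iff_of_nonneg fun j _ =>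
    mul_nonneg (hM.b_nonneg hC hirr.1 j) (sq_nonneg _)).1 hsum i (Finset.mem_univ i)
  simpa [(hM.b_pos hC hirr hi).ne'] using h0
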